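/- Let $\boldsymbol x\sim\mathcal N(0,\Sigma_x)$ be a Gaussian random vector in $\mathbb R^p$ with $\Sigma_x\succ O$. There are $m$ senders $i\in[m]$ and a receiver $r$. Sender $i$ commits to a Borel measurable policy $\eta_i:\mathbb R^p\to\mathbb R^p$ and sends $\boldsymbol y_i=\eta_i(\boldsymbol x)$; the receiver then takes the action $\boldsymbol u=\gamma(\boldsymbol y_1,\dots,\boldsymbol y_m)\in\mathbb R^t$ with $\gamma$ Borel measurable. Each player $i\in\{1,\dots,m,r\}$ has the expected cost $J_i(\eta_1,\dots,\eta_m;\gamma)=\mathbb E\,\|Q_i\boldsymbol x+R_i\boldsymbol u\|^2$, where $Q_i\in\mathbb R^{q\times p}$, $R_i\in\mathbb R^{q\times t}$ and $R_r^\top R_r$ is invertible. For announced policies $\eta$ the receiver uses a best response $\gamma^*(\eta)$, i.e. a minimizer of $J_r(\eta;\cdot)$. The policies $(\eta_i^*)_{i\in[m]}$ are Nash equilibrium policies if $J_i(\eta^*;\gamma^*(\eta^*))\le J_i(\eta_i,\eta_{-i}^*;\gamma^*(\eta_i,\eta_{-i}^*))$ for every $i$ and every Borel measurable $\eta_i$.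 The posterior induced by $\eta$ is $\mathbb E[\hat{\boldsymbol x}\hat{\boldsymbol x}^\top]$ with $\hat{\boldsymbol x}=\mathbb E[\boldsymbol x\mid\boldsymbol y_1,\dots,\boldsymbol y_m]$. For $i\in[m]$ put $\Lambda_i=R_i(R_r^\top R_r)^{-1}R_r^\top Q_r$ and $V_i=\Lambda_i^\top\Lambda_i-\Lambda_i^\top Q_i-Q_i^\top\Lambda_i$. Let $k_1,\dots,k_m$ be any ordering of the senders, let $T_0=O$, and for $j=1,\dots,m$, with $i=k_j$: let $S_i$ be a minimizer of $\mathrm{Tr}(V_iS)$ over $\Sigma_x\succeq S\succeq T_{j-1}$, and let $T_j$ be a minimizer of the nuclear norm $\|\Sigma_x^{-1/2}S'\Sigma_x^{-1/2}\|_*$ over $\Sigma_x\succeq S'\succeq T_{j-1}$ with $\mathrm{Tr}(V_iS_i)\ge\mathrm{Tr}(V_iS')$. Let $\Sigma^*=T_m$ and $P'=\Sigma_x^{-1/2}\Sigma^*\Sigma_x^{-1/2}$. Then: 1. $\Sigma^*$ is stable for every sender: $\min_{\Sigma_x\succeq S\succeq\Sigma^*}\mathrm{Tr}(V_iS)=\mathrm{Tr}(V_i\Sigma^*)$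 for all $i\in[m]$. 2. $P'$ is an (orthogonal) projection matrix, and $\Sigma^*=\Sigma_x^{1/2}P'\Sigma_x^{1/2}$. 3. For every eigendecomposition $P'=U_{P'}\Lambda_{P'}U_{P'}^\top$ ($U_{P'}$ orthogonal, $\Lambda_{P'}$ diagonal), the common linear policy $\eta_i(\boldsymbol x)=L\boldsymbol x$, $i\in[m]$, with $L^\top=\Sigma_x^{-1/2}U_{P'}\Lambda_{P'}$, constitutes Nash equilibrium policies of the $m$-sender game, and it induces the posterior $\Sigma^*$. -/

import Mathlib

open MeasureTheory ProbabilityTheory Matrix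
open scoped MatrixOrder ENNReal

noncomputable section

namespace StrategicCommunication

/-! ### The game -/

/-- Signaling policies of the senders: sender `i` sends `η i x` when the state is `x`. -/
abbrev Policies (m p : ℕ) : Type :=
  Fin m → EuclideanSpace ℝ (Fin p) → EuclideanSpace ℝ (Fin p)

/-- Strategies of the receiver: an action in `ℝ^t` for every tuple of received signals. -/
abbrev Response (m p t : ℕ) : Type :=
  (Fin m → EuclideanSpace ℝ (Fin p)) → EuclideanSpace ℝ (Fin t)

section Game

variable {m p q t : ℕ} {Ω : Type*} [MeasurableSpace Ω]
  (P : Measure Ω) (x : Ω → EuclideanSpace ℝ (Fin p))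

/-- The tuple of signals received by the receiver. -/
def signals (η : Policies m p) (ω : Ω) : Fin m → EuclideanSpace ℝ (Fin p) :=
  fun i => η i (x ω)

/-- The expected quadratic cost `E ‖Q x + R u‖²`, where `u` is the action taken by the receiver.
It takes values in `[0, ∞]`, so that it is meaningful for every measurable strategy. -/
def expectedCost (Q : Matrix (Fin q) (Fin p) ℝ) (R : Matrix (Fin q) (Fin t) ℝ)
    (η : Policies m p) (γ : Response m p t) : ℝ≥0∞ :=
  ∫⁻ ω, ‖toEuclideanLin Q (x ω) + toEuclideanLin R (γ (signals x η ω))‖ₑ ^ 2 ∂P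

/-- `γ` minimizes the expected cost of the receiver among all Borel measurable strategies, when
the senders are committed to the policies `η`. -/
def IsBestResponse (Qr : Matrix (Fin q) (Fin p) ℝ) (Rr : Matrix (Fin q) (Fin t) ℝ)
    (η : Policies m p) (γ : Response m p t) : Prop :=
  Measurable γ ∧ ∀ γ' : Response m p t, Measurable γ' →
    expectedCost P x Qr Rr η γ ≤ expectedCost P x Qr Rr η γ'

/-- `γ` assigns to every tuple of Borel measurable sender policies a best response of the
receiver. -/
def IsBestResponseMap (Qr : Matrix (Fin q) (Fin p) ℝ) (Rr : Matrix (Fin q) (Fin t) ℝ)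
    (γ : Policies m p → Response m p t) : Prop :=
  ∀ η : Policies m p, (∀ i, Measurable (η i)) → IsBestResponse P x Qr Rr η (γ η)

/-- The policies `η` and the receiver's reaction rule `γ` form a (hierarchical) equilibrium:
the receiver responds optimally to all announced policies, and no sender can decrease its expected
cost by announcing another Borel measurable policy, the receiver reacting to the deviation. -/
def IsEquilibrium (Q : Fin m → Matrix (Fin q) (Fin p) ℝ) (R : Fin m → Matrix (Fin q) (Fin t) ℝ)
    (Qr : Matrix (Fin q) (Fin p) ℝ) (Rr : Matrix (Fin q) (Fin t) ℝ)
    (η : Policies m p) (γ : Policies m p → Response m p t) : Prop :=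
  (∀ i, Measurable (η i)) ∧ IsBestResponseMap P x Qr Rr γ ∧
    ∀ (i : Fin m) (η' : EuclideanSpace ℝ (Fin p) → EuclideanSpace ℝ (Fin p)), Measurable η' →
      expectedCost P x (Q i) (R i) η (γ η) ≤
        expectedCost P x (Q i) (R i) (Function.update η i η') (γ (Function.update η i η'))

/-- The policies `η` are Nash equilibrium policies: best response maps of the receiver exist, and
together with any of them `η` is an equilibrium. -/
def IsNashPolicies (Q : Fin m → Matrix (Fin q) (Fin p) ℝ) (R : Fin m → Matrix (Fin q) (Fin t) ℝ)
    (Qr : Matrix (Fin q) (Fin p) ℝ) (Rr : Matrix (Fin q) (Fin t) ℝ) (η : Policies m p) : Prop :=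
  (∃ γ : Policies m p → Response m p t, IsBestResponseMap P x Qr Rr γ) ∧
    ∀ γ : Policies m p → Response m p t, IsBestResponseMap P x Qr Rr γ →
      IsEquilibrium P x Q R Qr Rr η γ

/-- The receiver's posterior estimate `x̂ = E[x | y₁, …, yₘ]`. -/
def posteriorEstimate (η : Policies m p) : Ω → EuclideanSpace ℝ (Fin p) :=
  P[x | MeasurableSpace.comap (signals x η) inferInstance]

/-- The posterior covariance `E[x̂ x̂ᵀ]` induced by the policies `η` (for a centered state). -/
def posteriorCov (η : Policies m p) : Matrix (Fin p) (Fin p) ℝ :=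
  Matrix.of fun a b => ∫ ω, posteriorEstimate P x η ω a * posteriorEstimate P x η ω b ∂P

end Game

/-! ### The sequential semidefinite programs -/

section SDP

variable {m p q t : ℕ}

/-- The matrix `Λ = R (Rrᵀ Rr)⁻¹ Rrᵀ Qr` of a sender. -/
def responseMatrix (R : Matrix (Fin q) (Fin t) ℝ)
    (Qr : Matrix (Fin q) (Fin p) ℝ) (Rr : Matrix (Fin q) (Fin t) ℝ) :
    Matrix (Fin q) (Fin p) ℝ :=
  R * (Rrᵀ * Rr)⁻¹ * Rrᵀ * Qr

/-- The matrix `V = Λᵀ Λ - Λᵀ Q - Qᵀ Λ` of a sender. -/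
def costMatrix (Q : Matrix (Fin q) (Fin p) ℝ) (R : Matrix (Fin q) (Fin t) ℝ)
    (Qr : Matrix (Fin q) (Fin p) ℝ) (Rr : Matrix (Fin q) (Fin t) ℝ) :
    Matrix (Fin p) (Fin p) ℝ :=
  (responseMatrix R Qr Rr)ᵀ * responseMatrix R Qr Rr
    - (responseMatrix R Qr Rr)ᵀ * Q - Qᵀ * responseMatrix R Qr Rr

/-- The positive semidefinite matrices `S` with `Sx ⪰ S ⪰ S₀`. -/
def feasible (Sx S₀ : Matrix (Fin p) (Fin p) ℝ) : Set (Matrix (Fin p) (Fin p) ℝ) :=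
  {S | S.PosSemidef ∧ (S - S₀).PosSemidef ∧ (Sx - S).PosSemidef}

/-- `S` is stable for a sender with cost matrix `V`: it is itself a minimizer of `Tr (V S')` over
all `S'` with `Sx ⪰ S' ⪰ S`. -/
def IsStable (Sx V S : Matrix (Fin p) (Fin p) ℝ) : Prop :=
  S ∈ feasible Sx S ∧ ∀ S' ∈ feasible Sx S, (V * S).trace ≤ (V * S').trace

/-- The nuclear norm of a matrix: the sum of its singular values. -/
def nuclearNorm (A : Matrix (Fin p) (Fin p) ℝ) : ℝ :=
  ∑ k ∈ Finset.range p, (toEuclideanLin A).singularValues k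

/-- `Sx^{-1/2} S Sx^{-1/2}`. -/
def whiten (Sx S : Matrix (Fin p) (Fin p) ℝ) : Matrix (Fin p) (Fin p) ℝ :=
  (CFC.sqrt Sx)⁻¹ * S * (CFC.sqrt Sx)⁻¹

/-- One iteration, for a sender with cost matrix `V`, from the current posterior `S₀` to a new one
`S'`: first `Tr (V S)` is minimized over `Sx ⪰ S ⪰ S₀`, then the nuclear norm of
`Sx^{-1/2} S' Sx^{-1/2}` over those `S'` with `Sx ⪰ S' ⪰ S₀` and `Tr (V S) ≥ Tr (V S')`. -/
def IsStep (Sx V S₀ S' : Matrix (Fin p) (Fin p) ℝ) : Prop :=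
  ∃ S ∈ feasible Sx S₀, (∀ T ∈ feasible Sx S₀, (V * S).trace ≤ (V * T).trace) ∧
    S' ∈ feasible Sx S₀ ∧ (V * S').trace ≤ (V * S).trace ∧
    ∀ T ∈ feasible Sx S₀, (V * T).trace ≤ (V * S).trace →
      nuclearNorm (whiten Sx S') ≤ nuclearNorm (whiten Sx T)

/-- `S` is returned by the sequential algorithm for senders with cost matrices `V i`, processed in
the order `N 0, N 1, …, N (m - 1)` and starting from the zero matrix. -/
def IsAlgorithmOutput (Sx : Matrix (Fin p) (Fin p) ℝ) (V : Fin m → Matrix (Fin p) (Fin p) ℝ)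
    (N : Equiv.Perm (Fin m)) (S : Matrix (Fin p) (Fin p) ℝ) : Prop :=
  ∃ T : Fin (m + 1) → Matrix (Fin p) (Fin p) ℝ, T 0 = 0 ∧
    (∀ j : Fin m, IsStep Sx (V (N j)) (T j.castSucc) (T j.succ)) ∧ T (Fin.last m) = S

end SDP

end StrategicCommunication

end

noncomputable section

namespace StrategicCommunication

/-! ### Positive semidefinite matrices and projections -/

section MatrixLemmas

variable {n : Type*} [Fintype n]

/-! Conjugation by `Sx`^{-1/2} turns the constraint `Sx ⪰ S ⪰ T` into `1 ⪰ X ⪰ P₀`. If `P₀` is a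
projection, every such `X` is the identity on the range of `P₀`, so the linear cost only sees the
compression `A` of the cost matrix to the orthogonal complement. A minimizer must be the identity on
the negative eigenspace of `A`, with projection `N`, hence dominates `P₀ + N`, which is itself a
minimizer. On positive semidefinite matrices the nuclear norm is the trace, so the second program
selects exactly `P₀ + N`. By induction from `0`, all iterates whiten to projections
(`isStarProjection_of_minimal`, `nuclearNorm_eq_trace`).

A minimizer above `T` is stable, and stability survives any later increase of the posterior, because
an increment feasible above the larger matrix is feasible above the smaller one (`IsStable.mono`).
So the output is stable for every sender.

In the game, a best response is almost surely `-K x̂` (`IsBestResponse.ae_eq`), so each sender's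
cost is a constant plus `Tr (V Σ̂)`. For Gaussian `x` the linear policy splits `x` into a part read
off the signal and an independent centered part, which gives the posterior `S`
(`posteriorCov_linear`). If one sender deviates and another remains, the latter still reveals `L x`;
the new posterior lies between `S` and `Sx`, and stability rules out a gain. A lone sender can also
reveal less, but then the algorithm's single step has minimized over all posteriors. -/

lemma trace_mul_nonneg {A B : Matrix n n ℝ} (hA : A.PosSemidef) (hB : B.PosSemidef) :
    0 ≤ (A * B).trace := by
  classical
  obtain ⟨E, rfl⟩ := CStarAlgebra.nonneg_iff_eq_star_mul_self.mp hA.nonneg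
  rw [Matrix.mul_assoc, Matrix.trace_mul_comm]
  exact (hB.mul_mul_conjTranspose_same E).trace_nonneg

/-- With `A = Eᴴ E` and `B = Fᴴ F`, the trace is the squared Frobenius norm of `E Fᴴ`. This is the
complementary slackness used for the semidefinite programs. -/
lemma mul_eq_zero_of_trace_mul_eq_zero {A B : Matrix n n ℝ} (hA : A.PosSemidef)
    (hB : B.PosSemidef) (h : (A * B).trace = 0) : A * B = 0 := by
  classical
  obtain ⟨E, rfl⟩ := CStarAlgebra.nonneg_iff_eq_star_mul_self.mp hA.nonneg
  obtain ⟨F, rfl⟩ := CStarAlgebra.nonneg_iff_eq_star_mul_self.mp hB.nonneg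
  simp only [Matrix.star_eq_conjTranspose] at h ⊢
  have h0 : ((E * Fᴴ)ᴴ * (E * Fᴴ)).trace = 0 := by
    rw [← h, Matrix.conjTranspose_mul, Matrix.conjTranspose_conjTranspose, Matrix.mul_assoc,
      Matrix.trace_mul_comm]
    simp only [Matrix.mul_assoc]
  rw [Matrix.trace_conjTranspose_mul_self_eq_zero_iff] at h0
  calc Eᴴ * E * (Fᴴ * F) = Eᴴ * (E * Fᴴ) * F := by simp only [Matrix.mul_assoc]
    _ = 0 := by rw [h0, Matrix.mul_zero, Matrix.zero_mul]

lemma posSemidef_of_isStarProjection {N : Matrix n n ℝ} (hN : IsStarProjection N) :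
    N.PosSemidef :=
  Matrix.nonneg_iff_posSemidef.mp hN.nonneg

variable [DecidableEq n]

/-- The spectral projection `N` of a Hermitian matrix on its negative eigenvalues, with `G` the
inverse on the range of `N`. -/
lemma exists_negative_spectral_projection {A : Matrix n n ℝ} (hA : A.IsHermitian) :
    ∃ N G : Matrix n n ℝ, IsStarProjection N ∧ A * N = N * A ∧ (-(A * N)).PosSemidef ∧
      (A * (1 - N)).PosSemidef ∧ N = A * G ∧ N = G * A := by
  set U : Matrix n n ℝ := (hA.eigenvectorUnitary : Matrix n n ℝ) with hU
  set d := hA.eigenvalues with hd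
  have hUU : Uᴴ * U = 1 := Unitary.star_mul_self_of_mem hA.eigenvectorUnitary.2
  have hUU' : U * Uᴴ = 1 := Unitary.mul_star_self_of_mem hA.eigenvectorUnitary.2
  have hAe : A = U * diagonal d * Uᴴ := by
    have := hA.spectral_theorem
    rw [Unitary.conjStarAlgAut_apply] at this
    exact this
  -- Matrices diagonal in the eigenbasis of `A` multiply entrywise, so each claim becomes a scalar
  -- check at every eigenvalue.
  have hmul : ∀ a b : n → ℝ, (U * diagonal a * Uᴴ) * (U * diagonal b * Uᴴ) =
      U * diagonal (fun i => a i * b i) * Uᴴ := by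
    intro a b
    calc _ = U * diagonal a * (Uᴴ * U) * diagonal b * Uᴴ := by simp only [Matrix.mul_assoc]
      _ = _ := by rw [hUU, Matrix.mul_one, Matrix.mul_assoc U, diagonal_mul_diagonal]
  have hpsd : ∀ a : n → ℝ, (∀ i, 0 ≤ a i) → (U * diagonal a * Uᴴ).PosSemidef := fun a ha =>
    (Matrix.PosSemidef.diagonal (d := a) ha).mul_mul_conjTranspose_same U
  have h1 : (1 : Matrix n n ℝ) = U * diagonal (fun _ => 1) * Uᴴ := by
    rw [diagonal_one, Matrix.mul_one, hUU']
  refine ⟨U * diagonal (fun i => if d i < 0 then 1 else 0) * Uᴴ,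
    U * diagonal (fun i => if d i < 0 then (d i)⁻¹ else 0) * Uᴴ, ⟨?_, ?_⟩, ?_, ?_, ?_, ?_, ?_⟩
  · rw [IsIdempotentElem, hmul]
    congr 3; ext i
    by_cases h : d i < 0
    · simp [h]
    · simp [h]
  · exact (hpsd _ (fun i => by positivity)).1
  · rw [hAe, hmul, hmul]; simp [mul_comm]
  · rw [hAe, hmul, ← Matrix.neg_mul, ← Matrix.mul_neg, diagonal_neg]
    refine hpsd _ fun i => ?_
    by_cases h : d i < 0
    · simp [h, h.le]
    · simp [h]
  · rw [hAe, h1, ← Matrix.sub_mul, ← Matrix.mul_sub, diagonal_sub, hmul]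
    refine hpsd _ fun i => ?_
    by_cases h : d i < 0
    · simp [h]
    · simp only [h, if_false, sub_zero, mul_one]
      exact not_lt.mp h
  · rw [hAe, hmul]; congr 3; ext i
    by_cases h : d i < 0
    · simp [h, h.ne]
    · simp [h]
  · rw [hAe, hmul]; congr 3; ext i
    by_cases h : d i < 0
    · simp [h, h.ne]
    · simp [h]

/-- If `P₀ ≤ X ≤ 1` with `P₀` a projection, then `X` restricts to the identity on the range. -/
lemma projection_mul_of_between {P₀ X : Matrix n n ℝ} (hP : IsStarProjection P₀)
    (h0 : (X - P₀).PosSemidef) (h1 : (1 - X).PosSemidef) : P₀ * X = P₀ ∧ X * P₀ = P₀ := by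
  have hPs := posSemidef_of_isStarProjection hP
  have a := trace_mul_nonneg hPs h0
  have b := trace_mul_nonneg hPs h1
  have hPP : P₀ * P₀ = P₀ := hP.isIdempotentElem
  -- `a` says `Tr (P₀ X) ≥ Tr P₀`, while `b` gives the reverse inequality.
  have e : P₀ * (1 - X) = 0 := by
    refine mul_eq_zero_of_trace_mul_eq_zero hPs h1 (le_antisymm ?_ b)
    simp only [Matrix.mul_sub, Matrix.trace_sub, hPP, Matrix.mul_one] at a ⊢
    linarith
  have e1 : P₀ * X = P₀ := by
    rw [Matrix.mul_sub, Matrix.mul_one, sub_eq_zero] at e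
    exact e.symm
  refine ⟨e1, ?_⟩
  have hX : Xᴴ = X := by
    have := h1.1
    rw [Matrix.IsHermitian, Matrix.conjTranspose_sub, Matrix.conjTranspose_one] at this
    exact sub_right_injective this
  have := congrArg Matrix.conjTranspose e1
  rwa [Matrix.conjTranspose_mul, hX, hPs.1.eq] at this

/-- Among the minimizers of `Tr (V X)` over `P₀ ≤ X ≤ 1`, the one of least trace is a projection. -/
lemma isStarProjection_of_minimal {P₀ V X : Matrix n n ℝ} (hP : IsStarProjection P₀)
    (hV : V.IsHermitian) (h0 : (X - P₀).PosSemidef) (h1 : (1 - X).PosSemidef)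
    (hmin : ∀ Y : Matrix n n ℝ, (Y - P₀).PosSemidef → (1 - Y).PosSemidef →
      (V * X).trace ≤ (V * Y).trace)
    (htr : ∀ Y : Matrix n n ℝ, (Y - P₀).PosSemidef → (1 - Y).PosSemidef →
      (V * Y).trace ≤ (V * X).trace → X.trace ≤ Y.trace) :
    IsStarProjection X := by
  have hPP : P₀ * P₀ = P₀ := hP.isIdempotentElem
  have hPs := posSemidef_of_isStarProjection hP
  have hPH : P₀ᴴ = P₀ := hPs.1.eq
  -- The compression of the cost to the complement of the range of `P₀`, the only directions still
  -- free.
  set A := (1 - P₀) * V * (1 - P₀) with hAdef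
  have hA : A.IsHermitian := by
    rw [Matrix.IsHermitian, hAdef]
    simp only [Matrix.conjTranspose_mul, Matrix.conjTranspose_sub, Matrix.conjTranspose_one, hPH,
      hV.eq, Matrix.mul_assoc]
  have hPA : P₀ * A = 0 := by
    rw [hAdef, ← Matrix.mul_assoc, ← Matrix.mul_assoc, Matrix.mul_sub P₀, hPP]; simp
  have hAP : A * P₀ = 0 := by
    rw [hAdef, Matrix.mul_assoc, Matrix.sub_mul 1 P₀ P₀, hPP]; simp
  obtain ⟨N, G, hN, hcomm, hneg, hpos, hNA, hNG⟩ := exists_negative_spectral_projection hA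
  have hNN : N * N = N := hN.isIdempotentElem
  have hNs := posSemidef_of_isStarProjection hN
  have hPN : P₀ * N = 0 := by rw [hNA, ← Matrix.mul_assoc, hPA, Matrix.zero_mul]
  have hNP : N * P₀ = 0 := by rw [hNG, Matrix.mul_assoc, hAP, Matrix.mul_zero]
  have hproj : IsStarProjection (P₀ + N) := by
    refine ⟨?_, ?_⟩
    · rw [IsIdempotentElem, add_mul, mul_add, mul_add, hPP, hPN, hNP, hNN]; simp
    · exact hP.isSelfAdjoint.add hN.isSelfAdjoint
  have hT0 : ((P₀ + N) - P₀).PosSemidef := by simpa using hNs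
  have hT1 : (1 - (P₀ + N)).PosSemidef := posSemidef_of_isStarProjection hproj.one_sub
  have htrace : ∀ Y : Matrix n n ℝ, (Y - P₀).PosSemidef → (1 - Y).PosSemidef →
      (V * Y).trace = (V * P₀).trace + (A * Y).trace := by
    intro Y hY0 hY1
    obtain ⟨e1, e2⟩ := projection_mul_of_between hP hY0 hY1
    have : (1 - P₀) * Y * (1 - P₀) = Y - P₀ := by
      simp only [Matrix.sub_mul, Matrix.mul_sub, Matrix.one_mul, Matrix.mul_one, e1, e2, hPP]
      simp
    have h2 : (A * Y).trace = (V * ((1 - P₀) * Y * (1 - P₀))).trace := by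
      rw [hAdef, Matrix.mul_assoc, Matrix.mul_assoc, Matrix.trace_mul_comm]
      simp only [Matrix.mul_assoc]
    rw [h2, this, Matrix.mul_sub, Matrix.trace_sub]; ring
  have hAT : A * (P₀ + N) = A * N := by rw [Matrix.mul_add, hAP, zero_add]
  obtain ⟨eX1, eX2⟩ := projection_mul_of_between hP h0 h1
  have hXs : X.PosSemidef := by simpa using h0.add hPs
  have i1 : (A * X).trace ≤ (A * N).trace := by
    have := hmin _ hT0 hT1
    rw [htrace _ h0 h1, htrace _ hT0 hT1, hAT] at this
    linarith
  have i2 := trace_mul_nonneg hpos hXs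
  have i3 := trace_mul_nonneg hneg h1
  -- The gap to the candidate `P₀ + N` splits into two nonnegative traces. By optimality (`i1`)
  -- their sum is at most zero, so both vanish.
  have i4 : (A * X).trace - (A * N).trace =
      (A * (1 - N) * X).trace + (-(A * N) * (1 - X)).trace := by
    simp only [Matrix.mul_sub, Matrix.sub_mul, Matrix.mul_one, Matrix.neg_mul, Matrix.trace_sub,
      Matrix.trace_neg]
    ring
  have z : -(A * N) * (1 - X) = 0 :=
    mul_eq_zero_of_trace_mul_eq_zero hneg h1 (by linarith)
  have hNX : N * X = N := by
    -- `G` inverts `A` on the range of `N`, so `A N (1 - X) = 0` can be cancelled to `N (1 - X) =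
    -- 0`.
    have : N * (1 - X) = G * (A * N * (1 - X)) := by
      rw [← Matrix.mul_assoc, ← Matrix.mul_assoc, ← hNG, hNN]
    rw [Matrix.neg_mul, neg_eq_zero] at z
    rw [z, Matrix.mul_zero, Matrix.mul_sub, Matrix.mul_one, sub_eq_zero] at this
    exact this.symm
  have hXN : X * N = N := by
    have := congrArg Matrix.conjTranspose hNX
    rwa [Matrix.conjTranspose_mul, hXs.1.eq, hNs.1.eq] at this
  have hle : X.trace ≤ (P₀ + N).trace := by
    refine htr _ hT0 hT1 ?_
    rw [htrace _ h0 h1, htrace _ hT0 hT1, hAT]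
    linarith
  -- `X` is the identity on the range of `P₀ + N`, so the excess `X - (P₀ + N)` is a compression of
  -- `X`, hence positive semidefinite. Minimality of the trace makes it zero.
  have hZ : (1 - (P₀ + N)) * X * (1 - (P₀ + N)) = X - (P₀ + N) := by
    simp only [Matrix.sub_mul, Matrix.mul_sub, Matrix.add_mul, Matrix.mul_add, Matrix.one_mul,
      Matrix.mul_one, eX1, eX2, hNX, hXN, hPP, hNN, hPN, hNP]
    abel
  have hZs : (X - (P₀ + N)).PosSemidef := by
    rw [← hZ]
    have := hXs.mul_mul_conjTranspose_same (1 - (P₀ + N))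
    rwa [hT1.1.eq] at this
  have hz : X - (P₀ + N) = 0 := by
    rw [← hZs.trace_eq_zero_iff]
    refine le_antisymm ?_ hZs.trace_nonneg
    rw [Matrix.trace_sub]; linarith
  rw [sub_eq_zero.mp hz]
  exact hproj

end MatrixLemmas

/-! ### The nuclear norm of a positive semidefinite matrix -/

lemma eigenvalues_congr {E : Type*} [NormedAddCommGroup E] [InnerProductSpace ℝ E]
    [FiniteDimensional ℝ E] {T T' : E →ₗ[ℝ] E} (h : T = T') (hT : T.IsSymmetric)
    (hT' : T'.IsSymmetric) {k : ℕ} (hk : Module.finrank ℝ E = k) :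
    hT.eigenvalues hk = hT'.eigenvalues hk := by
  subst h
  rfl

/-- The singular values are the square roots of the eigenvalues of `A * A`, and the functional
calculus gives `A = √(A * A)`, whose trace is their sum. -/
lemma nuclearNorm_eq_trace {p : ℕ} {A : Matrix (Fin p) (Fin p) ℝ} (hA : A.PosSemidef) :
    nuclearNorm A = A.trace := by
  have hM : (A * A).IsHermitian := by
    rw [Matrix.IsHermitian, Matrix.conjTranspose_mul, hA.1.eq]
  have hT : LinearMap.adjoint (toEuclideanLin A) ∘ₗ toEuclideanLin A = toEuclideanLin (A * A) := by
    rw [← Matrix.toEuclideanLin_conjTranspose_eq_adjoint, hA.1.eq]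
    ext v
    simp [Matrix.toLpLin_apply]
  have h1 : nuclearNorm A = ∑ k, √(hM.eigenvalues k) := by
    -- `eigenvalues` is a reindexing of the sorted list `eigenvalues₀`, which is the one matching
    -- `singularValues`.
    have e : ∑ k : Fin p, √(hM.eigenvalues k) = ∑ k, √(hM.eigenvalues₀ k) :=
      Equiv.sum_comp (Fintype.equivOfCardEq (Fintype.card_fin _)).symm
        (fun k => √(hM.eigenvalues₀ k))
    rw [e, nuclearNorm]
    have hp : Finset.range p = Finset.range (Fintype.card (Fin p)) := by rw [Fintype.card_fin]
    rw [hp, Finset.sum_range]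
    refine Finset.sum_congr rfl fun k _ => ?_
    have hn : Module.finrank ℝ (EuclideanSpace ℝ (Fin p)) = Fintype.card (Fin p) :=
      finrank_euclideanSpace
    rw [LinearMap.singularValues_fin (toEuclideanLin A) hn k]
    exact congrArg Real.sqrt (congrFun (eigenvalues_congr hT _ _ hn) k)
  have h2 : A = hM.cfc Real.sqrt := by
    rw [← hM.cfc_eq]
    have hs : IsSelfAdjoint A := hA.1
    have hc : cfc (fun x : ℝ => √(x ^ 2)) A = cfc (fun x : ℝ => x) A :=
      cfc_congr fun x hx => Real.sqrt_sq (spectrum_nonneg_of_nonneg hA.nonneg hx)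
    rw [cfc_comp_pow Real.sqrt 2 A Real.continuous_sqrt.continuousOn hs, cfc_id' ℝ A hs,
      pow_two] at hc
    exact hc.symm
  conv_rhs => rw [h2]
  rw [h1, Matrix.IsHermitian.cfc, Unitary.conjStarAlgAut_apply, Matrix.trace_mul_comm,
    ← Matrix.mul_assoc]
  simp [Matrix.trace_diagonal]

/-! ### Whitening, stability and the sequential programs -/

section Algorithm

variable {p : ℕ} {Sx : Matrix (Fin p) (Fin p) ℝ}

lemma sqrt_mul_sqrt_of_posDef (hSx : Sx.PosDef) : CFC.sqrt Sx * CFC.sqrt Sx = Sx :=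
  CFC.sqrt_mul_sqrt_self _ hSx.posSemidef.nonneg

lemma isUnit_det_sqrt (hSx : Sx.PosDef) : IsUnit (CFC.sqrt Sx).det := by
  have h := (Matrix.isUnit_iff_isUnit_det _).mp hSx.isUnit
  rw [← sqrt_mul_sqrt_of_posDef hSx, Matrix.det_mul] at h
  exact isUnit_of_mul_isUnit_left h

lemma conjTranspose_sqrt : (CFC.sqrt Sx)ᴴ = CFC.sqrt Sx :=
  (CFC.sqrt_nonneg Sx).isSelfAdjoint

lemma sqrt_mul_whiten_mul_sqrt (hSx : Sx.PosDef) (S : Matrix (Fin p) (Fin p) ℝ) :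
    CFC.sqrt Sx * whiten Sx S * CFC.sqrt Sx = S := by
  have h := isUnit_det_sqrt hSx
  rw [whiten, ← Matrix.mul_assoc, ← Matrix.mul_assoc, Matrix.mul_nonsing_inv _ h, Matrix.one_mul,
    Matrix.mul_assoc, Matrix.nonsing_inv_mul _ h, Matrix.mul_one]

lemma whiten_sqrt_mul_mul_sqrt (hSx : Sx.PosDef) (W : Matrix (Fin p) (Fin p) ℝ) :
    whiten Sx (CFC.sqrt Sx * W * CFC.sqrt Sx) = W := by
  have h := isUnit_det_sqrt hSx
  rw [whiten, ← Matrix.mul_assoc, ← Matrix.mul_assoc, Matrix.nonsing_inv_mul _ h, Matrix.one_mul,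
    Matrix.mul_assoc, Matrix.mul_nonsing_inv _ h, Matrix.mul_one]

lemma whiten_self (hSx : Sx.PosDef) : whiten Sx Sx = 1 := by
  have := whiten_sqrt_mul_mul_sqrt hSx 1
  rwa [Matrix.mul_one, sqrt_mul_sqrt_of_posDef hSx] at this

lemma whiten_sub (S T : Matrix (Fin p) (Fin p) ℝ) :
    whiten Sx (S - T) = whiten Sx S - whiten Sx T := by
  simp only [whiten, Matrix.mul_sub, Matrix.sub_mul]

lemma posSemidef_whiten {S : Matrix (Fin p) (Fin p) ℝ} (hS : S.PosSemidef) :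
    (whiten Sx S).PosSemidef := by
  have := hS.mul_mul_conjTranspose_same (CFC.sqrt Sx)⁻¹
  rwa [Matrix.conjTranspose_nonsing_inv, conjTranspose_sqrt] at this

lemma posSemidef_whiten_iff (hSx : Sx.PosDef) {S : Matrix (Fin p) (Fin p) ℝ} :
    (whiten Sx S).PosSemidef ↔ S.PosSemidef := by
  refine ⟨fun h => ?_, posSemidef_whiten⟩
  have := h.mul_mul_conjTranspose_same (CFC.sqrt Sx)
  rwa [conjTranspose_sqrt, sqrt_mul_whiten_mul_sqrt hSx] at this

/-- Whitening the posterior conjugates the cost matrix by `√Sx`, so each program keeps its linear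
form with upper bound `1`. -/
lemma trace_mul_eq_whiten (hSx : Sx.PosDef) (V S : Matrix (Fin p) (Fin p) ℝ) :
    (V * S).trace = (CFC.sqrt Sx * V * CFC.sqrt Sx * whiten Sx S).trace := by
  conv_lhs => rw [← sqrt_mul_whiten_mul_sqrt hSx S]
  rw [Matrix.mul_assoc _ _ (whiten Sx S), Matrix.mul_assoc _ V, Matrix.trace_mul_comm (CFC.sqrt Sx)]
  simp only [Matrix.mul_assoc]

/-- The output of an iteration minimizes the cost of the sender over the feasible set. -/
lemma IsStep.trace_le {V S₀ S T : Matrix (Fin p) (Fin p) ℝ} (h : IsStep Sx V S₀ S)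
    (hT : T ∈ feasible Sx S₀) : (V * S).trace ≤ (V * T).trace := by
  obtain ⟨S', -, h1, -, h2, -⟩ := h
  exact h2.trans (h1 T hT)

lemma IsStep.mem_feasible {V S₀ S : Matrix (Fin p) (Fin p) ℝ} (h : IsStep Sx V S₀ S) :
    S ∈ feasible Sx S₀ := by
  obtain ⟨S', -, -, h, -⟩ := h
  exact h

lemma feasible_self {S₀ S : Matrix (Fin p) (Fin p) ℝ} (h : S ∈ feasible Sx S₀) :
    S ∈ feasible Sx S :=
  ⟨h.1, by simp [Matrix.PosSemidef.zero], h.2.2⟩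

lemma feasible_trans {S₀ S T : Matrix (Fin p) (Fin p) ℝ} (h : S ∈ feasible Sx S₀)
    (hT : T ∈ feasible Sx S) : T ∈ feasible Sx S₀ :=
  ⟨hT.1, by simpa using hT.2.1.add h.2.1, hT.2.2⟩

lemma IsStep.isStable {V S₀ S : Matrix (Fin p) (Fin p) ℝ} (h : IsStep Sx V S₀ S) :
    IsStable Sx V S :=
  ⟨feasible_self h.mem_feasible, fun _ hT => h.trace_le (feasible_trans h.mem_feasible hT)⟩

/-- Stability for a sender is preserved when the posterior becomes more informative. -/
lemma IsStable.mono {V S₀ S : Matrix (Fin p) (Fin p) ℝ} (h : IsStable Sx V S₀)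
    (hS : S ∈ feasible Sx S₀) : IsStable Sx V S := by
  refine ⟨feasible_self hS, fun T hT => ?_⟩
  -- The increment `T - S` is tested above `S₀` instead of above `S`; it stays below `Sx` because
  -- `S₀ ⪯ S`.
  have := h.2 (S₀ + (T - S)) ⟨h.1.1.add hT.2.1, by simpa using hT.2.1, ?_⟩
  · rw [Matrix.mul_add, Matrix.mul_sub, Matrix.trace_add, Matrix.trace_sub] at this
    linarith
  · have e : Sx - (S₀ + (T - S)) = (Sx - T) + (S - S₀) := by abel
    rw [e]
    exact hT.2.2.add hS.2.1

lemma IsStep.isStarProjection_whiten (hSx : Sx.PosDef) {V S₀ S : Matrix (Fin p) (Fin p) ℝ}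
    (hV : V.IsHermitian) (hS₀ : IsStarProjection (whiten Sx S₀)) (h : IsStep Sx V S₀ S) :
    IsStarProjection (whiten Sx S) := by
  have hS := h.mem_feasible
  -- Undoing the whitening makes every competitor in the interval from `whiten Sx S₀` to `1`
  -- feasible for the original programs.
  have key : ∀ Y : Matrix (Fin p) (Fin p) ℝ, (Y - whiten Sx S₀).PosSemidef →
      (1 - Y).PosSemidef → CFC.sqrt Sx * Y * CFC.sqrt Sx ∈ feasible Sx S₀ := by
    intro Y h0 h1
    refine ⟨?_, ?_, ?_⟩ <;> rw [← posSemidef_whiten_iff hSx]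
    · rw [whiten_sqrt_mul_mul_sqrt hSx]
      simpa using h0.add (posSemidef_of_isStarProjection hS₀)
    · rwa [whiten_sub, whiten_sqrt_mul_mul_sqrt hSx]
    · rwa [whiten_sub, whiten_sqrt_mul_mul_sqrt hSx, whiten_self hSx]
  refine isStarProjection_of_minimal (V := CFC.sqrt Sx * V * CFC.sqrt Sx) hS₀ ?_ ?_ ?_ ?_ ?_
  · rw [Matrix.IsHermitian, Matrix.conjTranspose_mul, Matrix.conjTranspose_mul, conjTranspose_sqrt,
      hV.eq, Matrix.mul_assoc]
  · rw [← whiten_sub]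
    exact posSemidef_whiten hS.2.1
  · rw [← whiten_self hSx, ← whiten_sub]
    exact posSemidef_whiten hS.2.2
  · intro Y h0 h1
    have := h.trace_le (key Y h0 h1)
    rwa [trace_mul_eq_whiten hSx V S, trace_mul_eq_whiten hSx V, whiten_sqrt_mul_mul_sqrt hSx]
      at this
  · intro Y h0 h1 hle
    obtain ⟨S', hS', hmin, -, hSS', hnuc⟩ := h
    have hY := key Y h0 h1
    have := hnuc _ hY ?_
    · rwa [whiten_sqrt_mul_mul_sqrt hSx, nuclearNorm_eq_trace (posSemidef_whiten hS.1),
        nuclearNorm_eq_trace] at this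
      simpa using h0.add (posSemidef_of_isStarProjection hS₀)
    · refine le_trans ?_ hSS'
      rwa [trace_mul_eq_whiten hSx V S, trace_mul_eq_whiten hSx V, whiten_sqrt_mul_mul_sqrt hSx]

variable {m : ℕ} {V : Fin m → Matrix (Fin p) (Fin p) ℝ} {N : Equiv.Perm (Fin m)}
  {S : Matrix (Fin p) (Fin p) ℝ}

/-- The posteriors computed by the algorithm whiten to projections and are stable for the senders
processed so far. -/
lemma isStarProjection_and_isStable_of_isStep (hSx : Sx.PosDef) (hV : ∀ i, (V i).IsHermitian)
    {T : Fin (m + 1) → Matrix (Fin p) (Fin p) ℝ} (h0 : T 0 = 0)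
    (hT : ∀ j : Fin m, IsStep Sx (V (N j)) (T j.castSucc) (T j.succ)) (j : Fin (m + 1)) :
    IsStarProjection (whiten Sx (T j)) ∧
      ∀ k : Fin m, k.castSucc < j → IsStable Sx (V (N k)) (T j) := by
  induction j using Fin.induction with
  | zero =>
    rw [h0]
    exact ⟨by simp [whiten], fun k hk => absurd hk (by simp)⟩
  | succ j ih =>
    obtain ⟨hP, hst⟩ := ih
    refine ⟨(hT j).isStarProjection_whiten hSx (hV _) hP, fun k hk => ?_⟩
    rcases (Fin.castSucc_lt_succ_iff.mp hk).lt_or_eq with h | rfl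
    · exact (hst k (Fin.castSucc_lt_castSucc_iff.mpr h)).mono (hT j).mem_feasible
    · exact (hT k).isStable

lemma IsAlgorithmOutput.isStarProjection_whiten (h : IsAlgorithmOutput Sx V N S) (hSx : Sx.PosDef)
    (hV : ∀ i, (V i).IsHermitian) : IsStarProjection (whiten Sx S) := by
  obtain ⟨T, h0, hT, rfl⟩ := h
  exact (isStarProjection_and_isStable_of_isStep hSx hV h0 hT _).1

lemma IsAlgorithmOutput.isStable (h : IsAlgorithmOutput Sx V N S) (hSx : Sx.PosDef)
    (hV : ∀ i, (V i).IsHermitian) (i : Fin m) : IsStable Sx (V i) S := by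
  obtain ⟨T, h0, hT, rfl⟩ := h
  -- `N.symm i` is the position of sender `i` in the processing order.
  have := (isStarProjection_and_isStable_of_isStep hSx hV h0 hT (Fin.last m)).2 (N.symm i)
    (Fin.castSucc_lt_last _)
  rwa [Equiv.apply_symm_apply] at this

/-- With a single sender, the output of the algorithm is globally optimal. -/
lemma IsAlgorithmOutput.trace_le_of_unique (h : IsAlgorithmOutput Sx V N S) (hm : m = 1)
    (i : Fin m) {T : Matrix (Fin p) (Fin p) ℝ} (hT : T ∈ feasible Sx 0) :
    (V i * S).trace ≤ (V i * T).trace := by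
  subst hm
  obtain ⟨R, h0, hR, rfl⟩ := h
  have := hR 0
  rw [Subsingleton.elim (N 0) i, Fin.castSucc_zero, h0] at this
  exact this.trace_le hT

/-- Without senders, the algorithm returns the zero matrix. -/
lemma IsAlgorithmOutput.eq_zero (h : IsAlgorithmOutput Sx V N S) (hm : m = 0) : S = 0 := by
  subst hm
  obtain ⟨R, h0, -, rfl⟩ := h
  exact h0

end Algorithm

/-! ### Second moments and conditional expectation -/

section CrossMoment

variable {Ω : Type*} {𝓖 mΩ : MeasurableSpace Ω} {P : Measure Ω} {k l r : ℕ}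

/-- The matrix `E[y zᵀ]` of mixed second moments of two random vectors. -/
def crossMoment (P : Measure Ω) (y : Ω → EuclideanSpace ℝ (Fin k))
    (z : Ω → EuclideanSpace ℝ (Fin l)) : Matrix (Fin k) (Fin l) ℝ :=
  Matrix.of fun a b => ∫ ω, y ω a * z ω b ∂P

lemma crossMoment_apply (y : Ω → EuclideanSpace ℝ (Fin k)) (z : Ω → EuclideanSpace ℝ (Fin l))
    (a : Fin k) (b : Fin l) : crossMoment P y z a b = ∫ ω, y ω a * z ω b ∂P := rfl

lemma memLp_apply {y : Ω → EuclideanSpace ℝ (Fin k)} (hy : MemLp y 2 P) (a : Fin k) :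
    MemLp (fun ω => y ω a) 2 P :=
  (PiLp.proj 2 (𝕜 := ℝ) (fun _ : Fin k => ℝ) a).comp_memLp' hy

lemma memLp_toEuclideanLin {y : Ω → EuclideanSpace ℝ (Fin k)} (hy : MemLp y 2 P)
    (A : Matrix (Fin l) (Fin k) ℝ) : MemLp (fun ω => toEuclideanLin A (y ω)) 2 P :=
  (toEuclideanLin A).toContinuousLinearMap.comp_memLp' hy

lemma integrable_mul_apply {y : Ω → EuclideanSpace ℝ (Fin k)} {z : Ω → EuclideanSpace ℝ (Fin l)}
    (hy : MemLp y 2 P) (hz : MemLp z 2 P) (a : Fin k) (b : Fin l) :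
    Integrable (fun ω => y ω a * z ω b) P :=
  (memLp_apply hy a).integrable_mul (memLp_apply hz b)

lemma crossMoment_congr {y y' : Ω → EuclideanSpace ℝ (Fin k)}
    {z z' : Ω → EuclideanSpace ℝ (Fin l)} (hy : y =ᵐ[P] y') (hz : z =ᵐ[P] z') :
    crossMoment P y z = crossMoment P y' z' := by
  ext a b
  refine integral_congr_ae ?_
  filter_upwards [hy, hz] with ω h1 h2
  rw [h1, h2]

lemma crossMoment_transpose (y : Ω → EuclideanSpace ℝ (Fin k))
    (z : Ω → EuclideanSpace ℝ (Fin l)) : (crossMoment P y z)ᵀ = crossMoment P z y := by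
  ext a b
  simp only [Matrix.transpose_apply, crossMoment_apply, mul_comm]

lemma toEuclideanLin_apply_apply (A : Matrix (Fin l) (Fin k) ℝ) (v : EuclideanSpace ℝ (Fin k))
    (i : Fin l) : toEuclideanLin A v i = ∑ a, A i a * v a := rfl

lemma crossMoment_toEuclideanLin_left {y : Ω → EuclideanSpace ℝ (Fin k)}
    {z : Ω → EuclideanSpace ℝ (Fin l)} (hy : MemLp y 2 P) (hz : MemLp z 2 P)
    (A : Matrix (Fin r) (Fin k) ℝ) :
    crossMoment P (fun ω => toEuclideanLin A (y ω)) z = A * crossMoment P y z := by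
  ext i b
  simp only [Matrix.mul_apply, crossMoment_apply, toEuclideanLin_apply_apply, Finset.sum_mul,
    mul_assoc]
  rw [integral_finsetSum _ fun a _ => (integrable_mul_apply hy hz a b).const_mul _]
  simp only [integral_const_mul]

lemma crossMoment_toEuclideanLin_right {y : Ω → EuclideanSpace ℝ (Fin k)}
    {z : Ω → EuclideanSpace ℝ (Fin l)} (hy : MemLp y 2 P) (hz : MemLp z 2 P)
    (B : Matrix (Fin r) (Fin l) ℝ) :
    crossMoment P y (fun ω => toEuclideanLin B (z ω)) = crossMoment P y z * Bᵀ := by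
  rw [← crossMoment_transpose, crossMoment_toEuclideanLin_left hz hy, Matrix.transpose_mul,
    crossMoment_transpose]

lemma crossMoment_toEuclideanLin {s : ℕ} {y : Ω → EuclideanSpace ℝ (Fin k)}
    {z : Ω → EuclideanSpace ℝ (Fin l)} (hy : MemLp y 2 P) (hz : MemLp z 2 P)
    (A : Matrix (Fin r) (Fin k) ℝ) (B : Matrix (Fin s) (Fin l) ℝ) :
    crossMoment P (fun ω => toEuclideanLin A (y ω)) (fun ω => toEuclideanLin B (z ω)) =
      A * crossMoment P y z * Bᵀ := by
  rw [crossMoment_toEuclideanLin_right (memLp_toEuclideanLin hy A) hz,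
    crossMoment_toEuclideanLin_left hy hz]

lemma crossMoment_add_left {y y' : Ω → EuclideanSpace ℝ (Fin k)}
    {z : Ω → EuclideanSpace ℝ (Fin l)} (hy : MemLp y 2 P) (hy' : MemLp y' 2 P)
    (hz : MemLp z 2 P) :
    crossMoment P (y + y') z = crossMoment P y z + crossMoment P y' z := by
  ext a b
  simp only [Matrix.add_apply, crossMoment_apply, Pi.add_apply, PiLp.add_apply, add_mul]
  exact integral_add (integrable_mul_apply hy hz a b) (integrable_mul_apply hy' hz a b)

lemma crossMoment_add_right {y : Ω → EuclideanSpace ℝ (Fin k)}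
    {z z' : Ω → EuclideanSpace ℝ (Fin l)} (hy : MemLp y 2 P) (hz : MemLp z 2 P)
    (hz' : MemLp z' 2 P) :
    crossMoment P y (z + z') = crossMoment P y z + crossMoment P y z' := by
  rw [← crossMoment_transpose, crossMoment_add_left hz hz' hy, Matrix.transpose_add,
    crossMoment_transpose, crossMoment_transpose]

lemma crossMoment_sub_left {y y' : Ω → EuclideanSpace ℝ (Fin k)}
    {z : Ω → EuclideanSpace ℝ (Fin l)} (hy : MemLp y 2 P) (hy' : MemLp y' 2 P)
    (hz : MemLp z 2 P) :
    crossMoment P (y - y') z = crossMoment P y z - crossMoment P y' z := by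
  ext a b
  simp only [Matrix.sub_apply, crossMoment_apply, Pi.sub_apply, PiLp.sub_apply, sub_mul]
  exact integral_sub (integrable_mul_apply hy hz a b) (integrable_mul_apply hy' hz a b)

lemma crossMoment_sub_right {y : Ω → EuclideanSpace ℝ (Fin k)}
    {z z' : Ω → EuclideanSpace ℝ (Fin l)} (hy : MemLp y 2 P) (hz : MemLp z 2 P)
    (hz' : MemLp z' 2 P) :
    crossMoment P y (z - z') = crossMoment P y z - crossMoment P y z' := by
  rw [← crossMoment_transpose, crossMoment_sub_left hz hz' hy, Matrix.transpose_sub,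
    crossMoment_transpose, crossMoment_transpose]

lemma posSemidef_crossMoment {y : Ω → EuclideanSpace ℝ (Fin k)} (hy : MemLp y 2 P) :
    (crossMoment P y y).PosSemidef := by
  refine Matrix.PosSemidef.of_dotProduct_mulVec_nonneg ?_ fun v => ?_
  · rw [Matrix.IsHermitian, Matrix.conjTranspose_eq_transpose_of_trivial, crossMoment_transpose]
  -- The quadratic form at `v` is the second moment of the scalar `⟨v, y⟩`, obtained from a one-row
  -- matrix.
  · have h := crossMoment_toEuclideanLin hy hy (Matrix.replicateRow (Fin 1) v)
      (Matrix.replicateRow (Fin 1) v)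
    have h2 : star v ⬝ᵥ crossMoment P y y *ᵥ v =
        (Matrix.replicateRow (Fin 1) v * crossMoment P y y *
          (Matrix.replicateRow (Fin 1) v)ᵀ) 0 0 := by
      rw [Matrix.mul_assoc, Matrix.mul_apply]
      rfl
    rw [h2, ← h, crossMoment_apply]
    exact integral_nonneg fun ω => mul_self_nonneg _

/-- Links the `[0, ∞]`-valued costs of the game to traces of moment matrices. -/
lemma lintegral_enorm_sq_eq {y : Ω → EuclideanSpace ℝ (Fin k)} (hy : MemLp y 2 P) :
    ∫⁻ ω, ‖y ω‖ₑ ^ 2 ∂P = ENNReal.ofReal (crossMoment P y y).trace := by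
  have h1 : (crossMoment P y y).trace = ∫ ω, ‖y ω‖ ^ 2 ∂P := by
    simp only [Matrix.trace, Matrix.diag_apply, crossMoment_apply]
    rw [← integral_finsetSum _ fun a _ => integrable_mul_apply hy hy a a]
    simp only [EuclideanSpace.real_norm_sq_eq]
    simp only [pow_two]
  rw [h1, ofReal_integral_eq_lintegral_ofReal
    ((memLp_two_iff_integrable_sq_norm hy.aestronglyMeasurable).mp hy)
    (Filter.Eventually.of_forall fun ω => by positivity)]
  refine lintegral_congr fun ω => ?_
  rw [ENNReal.ofReal_pow (norm_nonneg _), ofReal_norm]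

lemma memLp_two_of_lintegral_ne_top {y : Ω → EuclideanSpace ℝ (Fin k)}
    (hy : AEStronglyMeasurable y P) (h : ∫⁻ ω, ‖y ω‖ₑ ^ 2 ∂P ≠ ∞) : MemLp y 2 P := by
  refine ⟨hy, ?_⟩
  rw [eLpNorm_lt_top_iff_lintegral_rpow_enorm_lt_top (by simp) (by simp)]
  simpa using h.lt_top

lemma ae_eq_zero_of_trace_crossMoment {y : Ω → EuclideanSpace ℝ (Fin k)} (hy : MemLp y 2 P)
    (h : (crossMoment P y y).trace ≤ 0) : ∀ᵐ ω ∂P, y ω = 0 := by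
  have h0 := lintegral_enorm_sq_eq hy
  rw [ENNReal.ofReal_of_nonpos h,
    lintegral_eq_zero_iff' (hy.aestronglyMeasurable.enorm.pow_const 2)] at h0
  filter_upwards [h0] with ω hω
  simpa using hω

variable [IsProbabilityMeasure P]

/-- Conditioning one of two random vectors on the σ-algebra of the other does not change their
mixed moments. -/
lemma crossMoment_condExp_left (h𝓖 : 𝓖 ≤ mΩ) {y : Ω → EuclideanSpace ℝ (Fin k)}
    {z : Ω → EuclideanSpace ℝ (Fin l)} (hy : MemLp y 2 P) (hz : MemLp z 2 P)
    (hzm : AEStronglyMeasurable[𝓖] z P) :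
    crossMoment P (P[y | 𝓖]) z = crossMoment P y z := by
  ext a b
  simp only [crossMoment_apply]
  -- The form `(y, z) ↦ y_a z_b`; the conditionally known factor is pulled out of it.
  let B : EuclideanSpace ℝ (Fin k) →L[ℝ] EuclideanSpace ℝ (Fin l) →L[ℝ] ℝ :=
    (ContinuousLinearMap.mul ℝ ℝ).bilinearComp
      (PiLp.proj 2 (𝕜 := ℝ) (fun _ : Fin k => ℝ) a)
      (PiLp.proj 2 (𝕜 := ℝ) (fun _ : Fin l => ℝ) b)
  have h := condExp_bilin_of_aestronglyMeasurable_right B hzm (integrable_mul_apply hy hz a b)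
    (hy.integrable (by norm_num))
  have h2 := integral_congr_ae h
  rw [integral_condExp h𝓖] at h2
  exact h2.symm

lemma crossMoment_self_condExp (h𝓖 : 𝓖 ≤ mΩ)
    {y : Ω → EuclideanSpace ℝ (Fin k)} (hy : MemLp y 2 P) :
    crossMoment P y (P[y | 𝓖]) = crossMoment P (P[y | 𝓖]) (P[y | 𝓖]) :=
  (crossMoment_condExp_left h𝓖 hy (hy.condExp (by norm_num))
    stronglyMeasurable_condExp.aestronglyMeasurable).symm

/-- Conditioning decreases the second moment matrix. -/
lemma posSemidef_crossMoment_sub_condExp (h𝓖 : 𝓖 ≤ mΩ)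
    {y : Ω → EuclideanSpace ℝ (Fin k)} (hy : MemLp y 2 P) :
    (crossMoment P y y - crossMoment P (P[y | 𝓖]) (P[y | 𝓖])).PosSemidef := by
  have hc : MemLp (P[y | 𝓖]) 2 P := hy.condExp (by norm_num)
  have h := posSemidef_crossMoment (P := P) (hy.sub hc)
  -- The error `y - ŷ` is orthogonal to `ŷ`, so the difference is the second moment matrix of the
  -- error.
  have e : crossMoment P (y - P[y | 𝓖]) (y - P[y | 𝓖]) =
      crossMoment P y y - crossMoment P (P[y | 𝓖]) (P[y | 𝓖]) := by
    have h1 := crossMoment_self_condExp (P := P) h𝓖 hy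
    have h2 : crossMoment P (P[y | 𝓖]) y = crossMoment P (P[y | 𝓖]) (P[y | 𝓖]) := by
      rw [← crossMoment_transpose, h1, crossMoment_transpose]
    rw [crossMoment_sub_left hy hc (hy.sub hc), crossMoment_sub_right hy hy hc,
      crossMoment_sub_right hc hy hc, h1, h2, sub_self, sub_zero]
  rwa [e] at h

end CrossMoment

/-! ### Posterior covariances -/

section Posterior

variable {m p : ℕ} {Ω : Type*} [MeasurableSpace Ω] {P : Measure Ω}
  {x : Ω → EuclideanSpace ℝ (Fin p)}

lemma measurable_signals (hx : Measurable x) {η : Policies m p} (hη : ∀ i, Measurable (η i)) :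
    Measurable (signals x η) :=
  measurable_pi_lambda _ fun i => (hη i).comp hx

lemma posteriorCov_eq (η : Policies m p) :
    posteriorCov P x η = crossMoment P (posteriorEstimate P x η) (posteriorEstimate P x η) := rfl

lemma memLp_posteriorEstimate (hx2 : MemLp x 2 P) (η : Policies m p) :
    MemLp (posteriorEstimate P x η) 2 P :=
  hx2.condExp (by norm_num)

variable [IsProbabilityMeasure P]

lemma posteriorCov_mem_feasible (hx : Measurable x) (hx2 : MemLp x 2 P) {η : Policies m p}
    (hη : ∀ i, Measurable (η i)) : posteriorCov P x η ∈ feasible (crossMoment P x x) 0 := by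
  have h := posSemidef_crossMoment (memLp_posteriorEstimate hx2 η)
  exact ⟨h, by rwa [sub_zero],
    posSemidef_crossMoment_sub_condExp (measurable_signals hx hη).comap_le hx2⟩

/-- More informative signals induce a larger posterior covariance. -/
lemma posSemidef_posteriorCov_sub (hx : Measurable x) (hx2 : MemLp x 2 P) {η η' : Policies m p}
    (hη' : ∀ i, Measurable (η' i))
    (hle : MeasurableSpace.comap (signals x η) inferInstance ≤
      MeasurableSpace.comap (signals x η') inferInstance) :
    (posteriorCov P x η' - posteriorCov P x η).PosSemidef := by
  have h := (measurable_signals hx hη').comap_le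
  have h1 := posSemidef_crossMoment_sub_condExp (hle.trans h) (memLp_posteriorEstimate hx2 η')
  have h2 : P[posteriorEstimate P x η' | MeasurableSpace.comap (signals x η) inferInstance] =ᵐ[P]
      posteriorEstimate P x η := condExp_condExp_of_le hle h
  rwa [crossMoment_congr h2 h2] at h1

end Posterior

/-! ### Gaussian states -/

section Gaussian

variable {m p : ℕ} {Ω : Type*} [MeasurableSpace Ω] {P : Measure Ω}
  {x : Ω → EuclideanSpace ℝ (Fin p)} {Sx : Matrix (Fin p) (Fin p) ℝ}

lemma hasGaussianLaw_of_map_eq (hlaw : P.map x = multivariateGaussian 0 Sx) :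
    HasGaussianLaw x P :=
  ⟨by rw [hlaw]; infer_instance⟩

lemma integral_toEuclideanLin_eq_zero (hx : Measurable x)
    (hlaw : P.map x = multivariateGaussian 0 Sx) {k : ℕ} (A : Matrix (Fin k) (Fin p) ℝ) :
    ∫ ω, toEuclideanLin A (x ω) ∂P = 0 := by
  have h0 : ∫ ω, x ω ∂P = 0 := by
    have := integral_map (μ := P) hx.aemeasurable (f := fun v => v) (by fun_prop)
    rw [← this, hlaw, integral_id_multivariateGaussian]
  have := (toEuclideanLin A).toContinuousLinearMap.integral_comp_comm
    (hasGaussianLaw_of_map_eq hlaw).integrable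
  rw [h0, map_zero] at this
  exact this

variable [IsProbabilityMeasure P]

lemma crossMoment_self_eq (hSx : Sx.PosDef) (hx : Measurable x)
    (hlaw : P.map x = multivariateGaussian 0 Sx) : crossMoment P x x = Sx := by
  have hx2 := (hasGaussianLaw_of_map_eq hlaw).memLp_two
  ext a b
  have h1 := covariance_eval_multivariateGaussian (μ := 0) hSx.posSemidef a b
  have hm : ∀ a, ∫ ω, x ω a ∂P = 0 := by
    intro a
    have h0 := integral_toEuclideanLin_eq_zero hx hlaw (1 : Matrix (Fin p) (Fin p) ℝ)
    simp only [Matrix.toLpLin_one, LinearMap.id_apply] at h0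
    have := (PiLp.proj 2 (𝕜 := ℝ) (fun _ : Fin p => ℝ) a).integral_comp_comm
      (hasGaussianLaw_of_map_eq hlaw).integrable
    rw [h0, map_zero] at this
    exact this
  rw [← hlaw, covariance_map_fun (by fun_prop) (by fun_prop) hx.aemeasurable,
    covariance_eq_sub (memLp_apply hx2 a) (memLp_apply hx2 b), hm, zero_mul, sub_zero] at h1
  exact h1

/-- Uncorrelated linear images of a Gaussian vector are independent. -/
lemma indepFun_toEuclideanLin (hSx : Sx.PosDef) (hx : Measurable x)
    (hlaw : P.map x = multivariateGaussian 0 Sx) {k l : ℕ} (A : Matrix (Fin k) (Fin p) ℝ)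
    (B : Matrix (Fin l) (Fin p) ℝ) (h : A * Sx * Bᵀ = 0) :
    IndepFun (fun ω => toEuclideanLin A (x ω)) (fun ω => toEuclideanLin B (x ω)) P := by
  have hG := hasGaussianLaw_of_map_eq hlaw
  have hx2 := hG.memLp_two
  have hAB : HasGaussianLaw (fun ω => (toEuclideanLin A (x ω), toEuclideanLin B (x ω))) P :=
    hG.map_fun ((toEuclideanLin A).toContinuousLinearMap.prod
      (toEuclideanLin B).toContinuousLinearMap)
  refine hAB.indepFun_of_covariance_inner fun u v => ?_
  have hA := memLp_toEuclideanLin hx2 A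
  have hB := memLp_toEuclideanLin hx2 B
  have hc : crossMoment P (fun ω => toEuclideanLin A (x ω))
      (fun ω => toEuclideanLin B (x ω)) = 0 := by
    rw [crossMoment_toEuclideanLin hx2 hx2, crossMoment_self_eq hSx hx hlaw, h]
  have hAu : MemLp (fun ω => inner ℝ u (toEuclideanLin A (x ω))) 2 P :=
    (innerSL ℝ u).comp_memLp' hA
  have hBv : MemLp (fun ω => inner ℝ v (toEuclideanLin B (x ω))) 2 P :=
    (innerSL ℝ v).comp_memLp' hB
  rw [covariance_eq_sub hAu hBv]
  have e1 : ∫ ω, inner ℝ u (toEuclideanLin A (x ω)) ∂P = 0 := by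
    rw [integral_inner (hA.integrable (by norm_num)), integral_toEuclideanLin_eq_zero hx hlaw,
      inner_zero_right]
  rw [e1, zero_mul, sub_zero]
  have e2 : ∀ ω, inner ℝ u (toEuclideanLin A (x ω)) * inner ℝ v (toEuclideanLin B (x ω)) =
      ∑ a, ∑ b, u a * v b * (toEuclideanLin A (x ω) a * toEuclideanLin B (x ω) b) := by
    intro ω
    simp only [PiLp.inner_apply, RCLike.inner_apply, conj_trivial, Finset.sum_mul_sum]
    refine Finset.sum_congr rfl fun a _ => Finset.sum_congr rfl fun b _ => by ring
  simp only [Pi.mul_apply, e2]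
  rw [integral_finsetSum _ fun a _ => integrable_finsetSum _ fun b _ =>
    (integrable_mul_apply hA hB a b).const_mul _]
  refine Finset.sum_eq_zero fun a _ => ?_
  rw [integral_finsetSum _ fun b _ => (integrable_mul_apply hA hB a b).const_mul _]
  refine Finset.sum_eq_zero fun b _ => ?_
  rw [integral_const_mul]
  have := congrFun (congrFun hc a) b
  rw [crossMoment_apply] at this
  rw [this, Matrix.zero_apply, mul_zero]

end Gaussian

/-! ### The receiver's best response and the senders' costs -/

section BestResponse

variable {m p q t : ℕ} {Ω : Type*} [MeasurableSpace Ω] {P : Measure Ω} [IsProbabilityMeasure P]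
  {x : Ω → EuclideanSpace ℝ (Fin p)} {η : Policies m p}
  {Qr : Matrix (Fin q) (Fin p) ℝ} {Rr : Matrix (Fin q) (Fin t) ℝ}

/-- The feedback matrix of the receiver's best response `u = -K x̂`. -/
def receiverGain (Qr : Matrix (Fin q) (Fin p) ℝ) (Rr : Matrix (Fin q) (Fin t) ℝ) :
    Matrix (Fin t) (Fin p) ℝ :=
  (Rrᵀ * Rr)⁻¹ * Rrᵀ * Qr

/-- The normal equations of the receiver's least squares problem. -/
lemma transpose_mul_mul_receiverGain (hRr : IsUnit (Rrᵀ * Rr)) :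
    Rrᵀ * (Rr * receiverGain Qr Rr) = Rrᵀ * Qr := by
  have h := (Matrix.isUnit_iff_isUnit_det _).mp hRr
  rw [receiverGain, ← Matrix.mul_assoc, Matrix.mul_assoc (Rrᵀ * Rr)⁻¹,
    Matrix.mul_nonsing_inv_cancel_left _ _ h]

lemma toEuclideanLin_mul_apply {k l r : ℕ} (A : Matrix (Fin k) (Fin l) ℝ)
    (B : Matrix (Fin l) (Fin r) ℝ) (v : EuclideanSpace ℝ (Fin r)) :
    toEuclideanLin (A * B) v = toEuclideanLin A (toEuclideanLin B v) := by
  rw [Matrix.toLpLin_mul 2 2 2]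
  rfl

lemma toEuclideanLin_leftInverse (hRr : IsUnit (Rrᵀ * Rr)) (u : EuclideanSpace ℝ (Fin t)) :
    toEuclideanLin ((Rrᵀ * Rr)⁻¹ * Rrᵀ) (toEuclideanLin Rr u) = u := by
  rw [← toEuclideanLin_mul_apply, Matrix.mul_assoc,
    Matrix.nonsing_inv_mul _ ((Matrix.isUnit_iff_isUnit_det _).mp hRr), Matrix.toLpLin_one]
  rfl

lemma measurable_toEuclideanLin {k l : ℕ} (A : Matrix (Fin k) (Fin l) ℝ) :
    Measurable (toEuclideanLin A) :=
  (toEuclideanLin A).toContinuousLinearMap.continuous.measurable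

/-- A version of the best response: a measurable function of the signals equal to `-K x̂`. -/
lemma exists_measurable_response (P : Measure Ω) (x : Ω → EuclideanSpace ℝ (Fin p))
    (η : Policies m p) (K : Matrix (Fin t) (Fin p) ℝ) :
    ∃ γ : Response m p t, Measurable γ ∧
      ∀ ω, γ (signals x η ω) = -toEuclideanLin K (posteriorEstimate P x η ω) := by
  have hm : Measurable[MeasurableSpace.comap (signals x η) inferInstance]
      (posteriorEstimate P x η) := stronglyMeasurable_condExp.measurable
  -- Doob–Dynkin factorization of `x̂` through the signals.
  obtain ⟨h, hh, he⟩ := hm.exists_eq_measurable_comp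
  refine ⟨fun y => -toEuclideanLin K (h y), ((measurable_toEuclideanLin K).comp hh).neg,
    fun ω => ?_⟩
  rw [he]
  rfl

/-- The expected cost of a player when the receiver takes the action `-K x̂`. -/
lemma lintegral_cost_eq (hx : Measurable x) (hx2 : MemLp x 2 P) (hη : ∀ i, Measurable (η i))
    (Q Λ : Matrix (Fin q) (Fin p) ℝ) :
    ∫⁻ ω, ‖toEuclideanLin Q (x ω) - toEuclideanLin Λ (posteriorEstimate P x η ω)‖ₑ ^ 2 ∂P =
      ENNReal.ofReal ((Q * crossMoment P x x * Qᵀ).trace +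
        ((Λᵀ * Λ - Λᵀ * Q - Qᵀ * Λ) * posteriorCov P x η).trace) := by
  have hc := memLp_posteriorEstimate hx2 η
  have hQ := memLp_toEuclideanLin hx2 Q
  have hΛ := memLp_toEuclideanLin hc Λ
  refine (lintegral_enorm_sq_eq (hQ.sub hΛ)).trans (congrArg ENNReal.ofReal ?_)
  have h1 : crossMoment P x (posteriorEstimate P x η) = posteriorCov P x η :=
    crossMoment_self_condExp (measurable_signals hx hη).comap_le hx2
  have h2 : crossMoment P (posteriorEstimate P x η) x = posteriorCov P x η := by
    rw [← crossMoment_transpose, h1, posteriorCov_eq, crossMoment_transpose]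
  set f : Ω → EuclideanSpace ℝ (Fin q) := fun ω => toEuclideanLin Q (x ω)
  set g : Ω → EuclideanSpace ℝ (Fin q) :=
    fun ω => toEuclideanLin Λ (posteriorEstimate P x η ω)
  have e : crossMoment P (f - g) (f - g) =
      Q * crossMoment P x x * Qᵀ - Q * posteriorCov P x η * Λᵀ -
        (Λ * posteriorCov P x η * Qᵀ - Λ * posteriorCov P x η * Λᵀ) := by
    rw [crossMoment_sub_left hQ hΛ (hQ.sub hΛ), crossMoment_sub_right hQ hQ hΛ,
      crossMoment_sub_right hΛ hQ hΛ, crossMoment_toEuclideanLin hx2 hx2,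
      crossMoment_toEuclideanLin hx2 hc, crossMoment_toEuclideanLin hc hx2,
      crossMoment_toEuclideanLin hc hc, h1, h2, posteriorCov_eq]
  rw [e]
  simp only [Matrix.sub_mul, Matrix.trace_sub]
  rw [Matrix.trace_mul_cycle Q (posteriorCov P x η), Matrix.trace_mul_cycle Λ (posteriorCov P x η),
    Matrix.trace_mul_cycle Λ (posteriorCov P x η)]
  ring

lemma expectedCost_of_ae_eq {γ : Response m p t} {K : Matrix (Fin t) (Fin p) ℝ}
    (hγ : ∀ᵐ ω ∂P, γ (signals x η ω) = -toEuclideanLin K (posteriorEstimate P x η ω))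
    (hx : Measurable x) (hx2 : MemLp x 2 P) (hη : ∀ i, Measurable (η i))
    (Q : Matrix (Fin q) (Fin p) ℝ) (R : Matrix (Fin q) (Fin t) ℝ) :
    expectedCost P x Q R η γ = ENNReal.ofReal ((Q * crossMoment P x x * Qᵀ).trace +
      (((R * K)ᵀ * (R * K) - (R * K)ᵀ * Q - Qᵀ * (R * K)) * posteriorCov P x η).trace) := by
  rw [← lintegral_cost_eq hx hx2 hη]
  refine lintegral_congr_ae ?_
  filter_upwards [hγ] with ω hω
  rw [hω, map_neg, ← toEuclideanLin_mul_apply, ← sub_eq_add_neg]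

/-- A response of finite cost satisfies a Pythagorean identity around the action `-K x̂`. -/
lemma exists_residual (hRr : IsUnit (Rrᵀ * Rr)) (hx : Measurable x) (hx2 : MemLp x 2 P)
    (hη : ∀ i, Measurable (η i)) {γ γ₀ : Response m p t} (hγ : Measurable γ)
    (hγ₀ : ∀ ω, γ₀ (signals x η ω) =
      -toEuclideanLin (receiverGain Qr Rr) (posteriorEstimate P x η ω))
    (hfin : expectedCost P x Qr Rr η γ ≠ ∞) :
    ∃ w : Ω → EuclideanSpace ℝ (Fin q), MemLp w 2 P ∧
      (∀ ω, w ω = toEuclideanLin Rr (γ (signals x η ω) +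
        toEuclideanLin (receiverGain Qr Rr) (posteriorEstimate P x η ω))) ∧
      expectedCost P x Qr Rr η γ =
        expectedCost P x Qr Rr η γ₀ + ENNReal.ofReal (crossMoment P w w).trace := by
  set K := receiverGain Qr Rr with hK
  have hs := measurable_signals hx hη
  have hc := memLp_posteriorEstimate hx2 η
  have hum : Measurable (fun ω => γ (signals x η ω)) := hγ.comp hs
  -- Finite cost makes `Rr u` square integrable, and the left inverse of `Rr` passes this on to the
  -- action `u`.
  have hu : MemLp (fun ω => γ (signals x η ω)) 2 P := by
    have h1 : MemLp (fun ω => toEuclideanLin Qr (x ω) +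
        toEuclideanLin Rr (γ (signals x η ω))) 2 P :=
      memLp_two_of_lintegral_ne_top (((measurable_toEuclideanLin Qr).comp hx).add
        ((measurable_toEuclideanLin Rr).comp hum)).aestronglyMeasurable hfin
    have h2 := memLp_toEuclideanLin (h1.sub (memLp_toEuclideanLin hx2 Qr)) ((Rrᵀ * Rr)⁻¹ * Rrᵀ)
    convert h2 using 2 with ω
    simp only [Pi.sub_apply, add_sub_cancel_left]
    rw [toEuclideanLin_leftInverse hRr]
  set v : Ω → EuclideanSpace ℝ (Fin t) := fun ω => γ (signals x η ω) +
    toEuclideanLin K (posteriorEstimate P x η ω) with hv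
  have hv2 : MemLp v 2 P := hu.add (memLp_toEuclideanLin hc K)
  have hvm : AEStronglyMeasurable[MeasurableSpace.comap (signals x η) inferInstance] v P := by
    have a1 : Measurable[MeasurableSpace.comap (signals x η) inferInstance]
        (fun ω => γ (signals x η ω)) := hγ.comp (comap_measurable (signals x η))
    have a2 : Measurable[MeasurableSpace.comap (signals x η) inferInstance]
        (posteriorEstimate P x η) := stronglyMeasurable_condExp.measurable
    exact (a1.add ((measurable_toEuclideanLin K).comp a2)).stronglyMeasurable.aestronglyMeasurable
  have hw2 := memLp_toEuclideanLin hv2 Rr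
  refine ⟨fun ω => toEuclideanLin Rr (v ω), hw2, fun ω => rfl, ?_⟩
  have hQ := memLp_toEuclideanLin hx2 Qr
  have hΛ := memLp_toEuclideanLin hc (Rr * K)
  set h : Ω → EuclideanSpace ℝ (Fin q) := fun ω => toEuclideanLin Qr (x ω) -
    toEuclideanLin (Rr * K) (posteriorEstimate P x η ω) with hh
  have hh2 : MemLp h 2 P := hQ.sub hΛ
  have hX : crossMoment P (posteriorEstimate P x η) v = crossMoment P x v :=
    crossMoment_condExp_left hs.comap_le hx2 hv2 hvm
  -- Since `v` depends on the signals only, `x̂` may be replaced by `x` against it; the normal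
  -- equations then annihilate the cross term.
  have horth : (crossMoment P h (fun ω => toEuclideanLin Rr (v ω))).trace = 0 := by
    change (crossMoment P ((fun ω => toEuclideanLin Qr (x ω)) -
      fun ω => toEuclideanLin (Rr * K) (posteriorEstimate P x η ω)) _).trace = 0
    rw [crossMoment_sub_left hQ hΛ hw2, crossMoment_toEuclideanLin_left hx2 hw2,
      crossMoment_toEuclideanLin_left hc hw2, crossMoment_toEuclideanLin_right hx2 hv2,
      crossMoment_toEuclideanLin_right hc hv2, hX, ← Matrix.sub_mul, ← Matrix.mul_assoc,
      Matrix.trace_mul_comm, ← Matrix.mul_assoc, Matrix.mul_sub,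
      transpose_mul_mul_receiverGain hRr, sub_self, Matrix.zero_mul, Matrix.trace_zero]
  have e1 : expectedCost P x Qr Rr η γ =
      ∫⁻ ω, ‖h ω + toEuclideanLin Rr (v ω)‖ₑ ^ 2 ∂P := by
    refine lintegral_congr fun ω => ?_
    rw [hh, hv]
    simp only [map_add, toEuclideanLin_mul_apply]
    congr 2
    abel
  have e2 : expectedCost P x Qr Rr η γ₀ = ∫⁻ ω, ‖h ω‖ₑ ^ 2 ∂P := by
    refine lintegral_congr fun ω => ?_
    rw [hγ₀, map_neg, ← toEuclideanLin_mul_apply, ← sub_eq_add_neg]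
  rw [e1, e2, lintegral_enorm_sq_eq hh2,
    ← ENNReal.ofReal_add (posSemidef_crossMoment hh2).trace_nonneg
      (posSemidef_crossMoment hw2).trace_nonneg]
  refine (lintegral_enorm_sq_eq (hh2.add hw2)).trans (congrArg ENNReal.ofReal ?_)
  have horth' : (crossMoment P (fun ω => toEuclideanLin Rr (v ω)) h).trace = 0 := by
    rw [← crossMoment_transpose, Matrix.trace_transpose, horth]
  rw [crossMoment_add_left hh2 hw2 (hh2.add hw2), crossMoment_add_right hh2 hh2 hw2,
    crossMoment_add_right hw2 hh2 hw2]
  rw [Matrix.trace_add, Matrix.trace_add, Matrix.trace_add, horth, horth']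
  ring

lemma isBestResponse_of_eq (hRr : IsUnit (Rrᵀ * Rr)) (hx : Measurable x) (hx2 : MemLp x 2 P)
    (hη : ∀ i, Measurable (η i)) {γ₀ : Response m p t} (hm : Measurable γ₀)
    (hγ₀ : ∀ ω, γ₀ (signals x η ω) =
      -toEuclideanLin (receiverGain Qr Rr) (posteriorEstimate P x η ω)) :
    IsBestResponse P x Qr Rr η γ₀ := by
  refine ⟨hm, fun γ' hγ' => ?_⟩
  by_cases hfin : expectedCost P x Qr Rr η γ' = ∞
  · rw [hfin]; exact le_top
  · obtain ⟨w, -, -, he⟩ := exists_residual hRr hx hx2 hη hγ' hγ₀ hfin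
    rw [he]; exact le_self_add

/-- Every best response of the receiver equals `-K x̂` almost surely. -/
lemma IsBestResponse.ae_eq {γ : Response m p t} (h : IsBestResponse P x Qr Rr η γ)
    (hRr : IsUnit (Rrᵀ * Rr)) (hx : Measurable x) (hx2 : MemLp x 2 P)
    (hη : ∀ i, Measurable (η i)) :
    ∀ᵐ ω ∂P, γ (signals x η ω) =
      -toEuclideanLin (receiverGain Qr Rr) (posteriorEstimate P x η ω) := by
  obtain ⟨γ₀, hm, hγ₀⟩ := exists_measurable_response P x η (receiverGain Qr Rr)
  have h0 : expectedCost P x Qr Rr η γ₀ ≠ ∞ := by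
    rw [expectedCost_of_ae_eq (Filter.Eventually.of_forall hγ₀) hx hx2 hη]
    exact ENNReal.ofReal_ne_top
  have hle := h.2 γ₀ hm
  obtain ⟨w, hw2, hw, he⟩ := exists_residual hRr hx hx2 hη h.1 hγ₀
    (ne_top_of_le_ne_top h0 hle)
  -- Beating the response `-K x̂` is impossible, so the Pythagorean residual has zero norm; the left
  -- inverse of `Rr` turns this into equality of actions.
  have hz : (crossMoment P w w).trace ≤ 0 := by
    rw [← ENNReal.ofReal_eq_zero]
    rw [he] at hle
    exact le_zero_iff.mp ((ENNReal.add_le_add_iff_left h0).mp (hle.trans_eq (add_zero _).symm))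
  filter_upwards [ae_eq_zero_of_trace_crossMoment hw2 hz] with ω hω
  rw [hw] at hω
  have := congrArg (toEuclideanLin ((Rrᵀ * Rr)⁻¹ * Rrᵀ)) hω
  rw [toEuclideanLin_leftInverse hRr, map_zero] at this
  exact eq_neg_of_add_eq_zero_left this

lemma exists_isBestResponseMap (hRr : IsUnit (Rrᵀ * Rr)) (hx : Measurable x)
    (hx2 : MemLp x 2 P) :
    ∃ γ : Policies m p → Response m p t, IsBestResponseMap P x Qr Rr γ := by
  choose γ hm hγ using fun η : Policies m p =>
    exists_measurable_response P x η (receiverGain Qr Rr)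
  exact ⟨γ, fun η hη => isBestResponse_of_eq hRr hx hx2 hη (hm η) (hγ η)⟩

/-- The cost of a sender when the receiver responds optimally depends on the policies only through
`Tr (V Σ̂)`. -/
lemma IsBestResponse.expectedCost_eq {γ : Response m p t} (h : IsBestResponse P x Qr Rr η γ)
    (hRr : IsUnit (Rrᵀ * Rr)) (hx : Measurable x) (hx2 : MemLp x 2 P)
    (hη : ∀ i, Measurable (η i)) (Q : Matrix (Fin q) (Fin p) ℝ) (R : Matrix (Fin q) (Fin t) ℝ) :
    expectedCost P x Q R η γ = ENNReal.ofReal ((Q * crossMoment P x x * Qᵀ).trace +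
      (costMatrix Q R Qr Rr * posteriorCov P x η).trace) := by
  have e : responseMatrix R Qr Rr = R * receiverGain Qr Rr := by
    simp only [responseMatrix, receiverGain, Matrix.mul_assoc]
  rw [expectedCost_of_ae_eq (h.ae_eq hRr hx hx2 hη) hx hx2 hη, costMatrix, e]

/-- Policies are Nash equilibrium policies if no deviation decreases `Tr (V Σ̂)`. -/
lemma isNashPolicies_of_trace_le (hRr : IsUnit (Rrᵀ * Rr)) (hx : Measurable x)
    (hx2 : MemLp x 2 P) (hη : ∀ i, Measurable (η i)) {Q : Fin m → Matrix (Fin q) (Fin p) ℝ}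
    {R : Fin m → Matrix (Fin q) (Fin t) ℝ}
    (h : ∀ (i : Fin m) (η' : EuclideanSpace ℝ (Fin p) → EuclideanSpace ℝ (Fin p)), Measurable η' →
      (costMatrix (Q i) (R i) Qr Rr * posteriorCov P x η).trace ≤
        (costMatrix (Q i) (R i) Qr Rr * posteriorCov P x (Function.update η i η')).trace) :
    IsNashPolicies P x Q R Qr Rr η := by
  refine ⟨exists_isBestResponseMap hRr hx hx2, fun γ hγ => ⟨hη, hγ, fun i η' hη' => ?_⟩⟩
  have hu : ∀ j, Measurable (Function.update η i η' j) := by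
    intro j
    rcases eq_or_ne j i with rfl | hj
    · rwa [Function.update_self]
    · rw [Function.update_of_ne hj]
      exact hη j
  rw [(hγ η hη).expectedCost_eq hRr hx hx2 hη, (hγ _ hu).expectedCost_eq hRr hx hx2 hu]
  exact ENNReal.ofReal_le_ofReal (by linarith [h i η' hη'])

end BestResponse

lemma isHermitian_costMatrix {p q t : ℕ} (Q : Matrix (Fin q) (Fin p) ℝ)
    (R : Matrix (Fin q) (Fin t) ℝ) (Qr : Matrix (Fin q) (Fin p) ℝ)
    (Rr : Matrix (Fin q) (Fin t) ℝ) : (costMatrix Q R Qr Rr).IsHermitian := by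
  rw [Matrix.IsHermitian, Matrix.conjTranspose_eq_transpose_of_trivial, costMatrix]
  simp only [Matrix.transpose_sub, Matrix.transpose_mul, Matrix.transpose_transpose]
  abel

/-- The signals sent under `η` reveal what all senders would reveal by the policy of one of them. -/
lemma comap_signals_const_le {m p : ℕ} {Ω : Type*} {x : Ω → EuclideanSpace ℝ (Fin p)}
    {f : EuclideanSpace ℝ (Fin p) → EuclideanSpace ℝ (Fin p)}
    {η : Policies m p} (i : Fin m) (hi : η i = f) :
    MeasurableSpace.comap (signals x fun _ : Fin m => f) inferInstance ≤
      MeasurableSpace.comap (signals x η) inferInstance := by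
  have e : (signals x fun _ : Fin m => f) = (fun y _ => y i) ∘ signals x η := by
    ext ω j : 2
    simp [signals, hi]
  rw [e, ← MeasurableSpace.comap_comp]
  refine MeasurableSpace.comap_mono ?_
  have hm : Measurable (fun (y : Fin m → EuclideanSpace ℝ (Fin p)) (_ : Fin m) => y i) :=
    measurable_pi_lambda _ fun _ => measurable_pi_apply i
  exact hm.comap_le

/-! ### The posterior of the linear policy -/

section LinearPolicy

variable {m p : ℕ} {Ω : Type*} [MeasurableSpace Ω] {P : Measure Ω} [IsProbabilityMeasure P]
  {x : Ω → EuclideanSpace ℝ (Fin p)} {Sx S U L : Matrix (Fin p) (Fin p) ℝ} {d : Fin p → ℝ}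

/-- The posterior estimate induced by the linear policy. -/
lemma posteriorEstimate_linear (hSx : Sx.PosDef) (hx : Measurable x)
    (hlaw : P.map x = multivariateGaussian 0 Sx) (hm : m = 0 → S = 0)
    (hP : IsStarProjection (whiten Sx S)) (hU : U ∈ Matrix.orthogonalGroup (Fin p) ℝ)
    (hd : whiten Sx S = U * diagonal d * Uᵀ) (hL : Lᵀ = (CFC.sqrt Sx)⁻¹ * U * diagonal d) :
    posteriorEstimate P x (fun _ : Fin m => toEuclideanLin L) =ᵐ[P]
      fun ω => toEuclideanLin (CFC.sqrt Sx * whiten Sx S * (CFC.sqrt Sx)⁻¹) (x ω) := by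
  set C := CFC.sqrt Sx with hC
  set W := whiten Sx S with hW
  have hCu := isUnit_det_sqrt hSx
  have hCt : Cᵀ = C := by
    rw [← Matrix.conjTranspose_eq_transpose_of_trivial, hC, conjTranspose_sqrt]
  have hUU : Uᵀ * U = 1 := (Matrix.mem_orthogonalGroup_iff' _ _).mp hU
  have hWW : W * W = W := hP.isIdempotentElem
  have hWt : Wᵀ = W := by
    rw [← Matrix.conjTranspose_eq_transpose_of_trivial]
    exact hP.isSelfAdjoint
  have hLe : L = diagonal d * Uᵀ * C⁻¹ := by
    rw [← Matrix.transpose_transpose L, hL]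
    simp only [Matrix.transpose_mul, Matrix.diagonal_transpose, Matrix.transpose_nonsing_inv, hCt,
      Matrix.mul_assoc]
  have hdU : diagonal d * Uᵀ = Uᵀ * W := by
    rw [hd, ← Matrix.mul_assoc, ← Matrix.mul_assoc, hUU, Matrix.one_mul]
  -- `M x` will be the estimate and `M' x` the estimation error.
  set M := C * W * C⁻¹ with hM
  set M' := C * (1 - W) * C⁻¹ with hM'
  have hadd : M + M' = 1 := by
    rw [hM, hM', ← Matrix.add_mul, ← Matrix.mul_add, add_sub_cancel, Matrix.mul_one,
      Matrix.mul_nonsing_inv _ hCu]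
  have hML : M = C * U * L := by
    rw [hLe, hM, hd]
    simp only [Matrix.mul_assoc]
  -- The error is uncorrelated with the signal because `W (1 - W) = 0`; by Gaussianity it is then
  -- independent of it.
  have hunc : L * Sx * M'ᵀ = 0 := by
    have h1 : C⁻¹ * Sx * C⁻¹ = 1 := whiten_self hSx
    calc L * Sx * M'ᵀ = Uᵀ * W * (C⁻¹ * Sx * C⁻¹) * (1 - W) * C := by
          rw [hLe, hdU, hM']
          simp only [Matrix.transpose_mul, Matrix.transpose_nonsing_inv, hCt, Matrix.transpose_sub,
            Matrix.transpose_one, hWt, Matrix.mul_assoc]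
      _ = Uᵀ * (W * (1 - W)) * C := by rw [h1]; simp only [Matrix.mul_assoc, Matrix.one_mul]
      _ = 0 := by rw [Matrix.mul_sub W, hWW]; simp
  set η : Policies m p := fun _ => toEuclideanLin L with hη
  have hηm : ∀ i, Measurable (η i) := fun _ => measurable_toEuclideanLin L
  have hs := (measurable_signals hx hηm).comap_le
  have hG := hasGaussianLaw_of_map_eq hlaw
  have hi1 : Integrable (fun ω => toEuclideanLin M (x ω)) P :=
    (memLp_toEuclideanLin hG.memLp_two M).integrable (by norm_num)
  have hi2 : Integrable (fun ω => toEuclideanLin M' (x ω)) P :=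
    (memLp_toEuclideanLin hG.memLp_two M').integrable (by norm_num)
  have hind : IndepFun (fun ω => toEuclideanLin M' (x ω)) (signals x η) P := by
    have h := (indepFun_toEuclideanLin hSx hx hlaw L M' hunc).symm
    have hφ : Measurable (fun (y : EuclideanSpace ℝ (Fin p)) (_ : Fin m) => y) :=
      measurable_pi_lambda _ fun _ => measurable_id
    exact h.comp measurable_id hφ
  have hM'm : Measurable (fun ω => toEuclideanLin M' (x ω)) :=
    (measurable_toEuclideanLin M').comp hx
  have c2 : P[fun ω => toEuclideanLin M' (x ω) | MeasurableSpace.comap (signals x η) inferInstance]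
      =ᵐ[P] fun _ => 0 := by
    have := condExp_indep_eq hM'm.comap_le hs
      (comap_measurable (fun ω => toEuclideanLin M' (x ω))).stronglyMeasurable hind
    rwa [integral_toEuclideanLin_eq_zero hx hlaw] at this
  have c1 : P[fun ω => toEuclideanLin M (x ω) | MeasurableSpace.comap (signals x η) inferInstance]
      = fun ω => toEuclideanLin M (x ω) := by
    refine condExp_of_stronglyMeasurable hs ?_ hi1
    -- Without senders there is no signal to read `M x` from, but then `S = 0` forces `M = 0`.
    rcases Nat.eq_zero_or_pos m with h0 | hpos
    · have : M = 0 := by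
        rw [hM, hW, hm h0]
        simp [whiten]
      rw [this]
      simpa using stronglyMeasurable_const
    · have e : (fun ω => toEuclideanLin M (x ω)) =
          fun ω => toEuclideanLin (C * U) (signals x η ω ⟨0, hpos⟩) := by
        ext1 ω
        rw [hML, toEuclideanLin_mul_apply]
        rfl
      have h0 : Measurable (fun y : Fin m → EuclideanSpace ℝ (Fin p) =>
          toEuclideanLin (C * U) (y ⟨0, hpos⟩)) :=
        (measurable_toEuclideanLin (C * U)).comp (measurable_pi_apply _)
      have h1 : Measurable[MeasurableSpace.comap (signals x η) inferInstance]
          (fun ω => toEuclideanLin (C * U) (signals x η ω ⟨0, hpos⟩)) :=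
        h0.comp (comap_measurable (signals x η))
      rw [e]
      exact h1.stronglyMeasurable
  have hxe : x = (fun ω => toEuclideanLin M (x ω)) + fun ω => toEuclideanLin M' (x ω) := by
    ext1 ω
    rw [Pi.add_apply, ← LinearMap.add_apply, ← map_add, hadd, Matrix.toLpLin_one]
    rfl
  have hsum := condExp_add hi1 hi2 (MeasurableSpace.comap (signals x η) inferInstance)
  rw [← hxe, c1] at hsum
  filter_upwards [hsum, c2] with ω h1 h2
  rw [Pi.add_apply, h2, add_zero] at h1
  exact h1

/-- The linear policy induces the posterior `S`. -/
lemma posteriorCov_linear (hSx : Sx.PosDef) (hx : Measurable x)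
    (hlaw : P.map x = multivariateGaussian 0 Sx) (hm : m = 0 → S = 0)
    (hP : IsStarProjection (whiten Sx S)) (hU : U ∈ Matrix.orthogonalGroup (Fin p) ℝ)
    (hd : whiten Sx S = U * diagonal d * Uᵀ) (hL : Lᵀ = (CFC.sqrt Sx)⁻¹ * U * diagonal d) :
    posteriorCov P x (fun _ : Fin m => toEuclideanLin L) = S := by
  have h := posteriorEstimate_linear hSx hx hlaw hm hP hU hd hL
  have hx2 := (hasGaussianLaw_of_map_eq hlaw).memLp_two
  have hCt : (CFC.sqrt Sx)ᵀ = CFC.sqrt Sx := by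
    rw [← Matrix.conjTranspose_eq_transpose_of_trivial, conjTranspose_sqrt]
  have hWW : whiten Sx S * whiten Sx S = whiten Sx S := hP.isIdempotentElem
  have hWt : (whiten Sx S)ᵀ = whiten Sx S := by
    rw [← Matrix.conjTranspose_eq_transpose_of_trivial]
    exact hP.isSelfAdjoint
  have h1 : (CFC.sqrt Sx)⁻¹ * Sx * (CFC.sqrt Sx)⁻¹ = 1 := whiten_self hSx
  rw [posteriorCov_eq, crossMoment_congr h h,
    crossMoment_toEuclideanLin hx2 hx2, crossMoment_self_eq hSx hx hlaw]
  calc _ = CFC.sqrt Sx * whiten Sx S * ((CFC.sqrt Sx)⁻¹ * Sx * (CFC.sqrt Sx)⁻¹) *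
        whiten Sx S * CFC.sqrt Sx := by
          simp only [Matrix.transpose_mul, Matrix.transpose_nonsing_inv, hCt, hWt,
            Matrix.mul_assoc]
    _ = CFC.sqrt Sx * (whiten Sx S * whiten Sx S) * CFC.sqrt Sx := by
          rw [h1]; simp only [Matrix.mul_assoc, Matrix.one_mul]
    _ = S := by rw [hWW, sqrt_mul_whiten_mul_sqrt hSx]

end LinearPolicy

end StrategicCommunication
end

/-! ### The equilibrium theorem -/

open StrategicCommunication in
theorem theorem3 {m p q t : ℕ} {Ω : Type*} [MeasurableSpace Ω]
    (P : Measure Ω) [IsProbabilityMeasure P]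
    (Sx : Matrix (Fin p) (Fin p) ℝ) (hSx : Sx.PosDef)
    (x : Ω → EuclideanSpace ℝ (Fin p)) (hx : Measurable x)
    (hlaw : P.map x = multivariateGaussian 0 Sx)
    (Q : Fin m → Matrix (Fin q) (Fin p) ℝ) (R : Fin m → Matrix (Fin q) (Fin t) ℝ)
    (Qr : Matrix (Fin q) (Fin p) ℝ) (Rr : Matrix (Fin q) (Fin t) ℝ)
    (hRr : IsUnit (Rrᵀ * Rr))
    (N : Equiv.Perm (Fin m)) (S : Matrix (Fin p) (Fin p) ℝ)
    (hS : StrategicCommunication.IsAlgorithmOutput Sx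
      (fun i => StrategicCommunication.costMatrix (Q i) (R i) Qr Rr) N S) :
    (∀ i, StrategicCommunication.IsStable Sx
      (StrategicCommunication.costMatrix (Q i) (R i) Qr Rr) S) ∧
    IsStarProjection (StrategicCommunication.whiten Sx S) ∧
    S = CFC.sqrt Sx * StrategicCommunication.whiten Sx S * CFC.sqrt Sx ∧
    ∀ (U : Matrix (Fin p) (Fin p) ℝ) (d : Fin p → ℝ) (L : Matrix (Fin p) (Fin p) ℝ),
      U ∈ Matrix.orthogonalGroup (Fin p) ℝ →
      StrategicCommunication.whiten Sx S = U * Matrix.diagonal d * Uᵀ →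
      Lᵀ = (CFC.sqrt Sx)⁻¹ * U * Matrix.diagonal d →
      StrategicCommunication.IsNashPolicies P x Q R Qr Rr (fun _ => toEuclideanLin L) ∧
      StrategicCommunication.posteriorCov P x (fun _ : Fin m => toEuclideanLin L) = S := by
  have hV : ∀ i, (costMatrix (Q i) (R i) Qr Rr).IsHermitian := fun i =>
    isHermitian_costMatrix _ _ _ _
  have hst := hS.isStable hSx hV
  have hP := hS.isStarProjection_whiten hSx hV
  refine ⟨hst, hP, (sqrt_mul_whiten_mul_sqrt hSx S).symm, fun U d L hU hd hL => ?_⟩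
  have hx2 := (hasGaussianLaw_of_map_eq hlaw).memLp_two
  have hxx := crossMoment_self_eq hSx hx hlaw
  have hcov := posteriorCov_linear hSx hx hlaw hS.eq_zero hP hU hd hL
  have hLm : ∀ _ : Fin m, Measurable (toEuclideanLin L) := fun _ => measurable_toEuclideanLin L
  refine ⟨isNashPolicies_of_trace_le hRr hx hx2 hLm fun i η' hη' => ?_, hcov⟩
  rw [hcov]
  have hu : ∀ j, Measurable
      (Function.update (fun _ : Fin m => (toEuclideanLin L : _ → _)) i η' j) := by
    intro j
    rcases eq_or_ne j i with rfl | hj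
    · rwa [Function.update_self]
    · rw [Function.update_of_ne hj]
      exact hLm j
  have hf := posteriorCov_mem_feasible hx hx2 hu
  rw [hxx] at hf
  -- Another sender `j` keeps `L x` revealed, so the deviation can only enlarge the posterior and
  -- stability applies. Otherwise `m = 1` and global optimality is needed.
  by_cases hm : ∃ j, j ≠ i
  · obtain ⟨j, hj⟩ := hm
    have hle := posSemidef_posteriorCov_sub hx hx2 hu
      (comap_signals_const_le (x := x) j (Function.update_of_ne hj _ _))
    rw [hcov] at hle
    exact (hst i).2 _ ⟨hf.1, hle, hf.2.2⟩
  · push Not at hm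
    have h1 : m = 1 := by
      have : Subsingleton (Fin m) := ⟨fun a b => (hm a).trans (hm b).symm⟩
      have h2 := Fin.subsingleton_iff_le_one.mp this
      have := i.pos
      omega
    exact hS.trace_le_of_unique h1 i hf
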